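/- Let $G$ be a countably infinite, locally finite abelian group (with the discrete topology), let $\widehat G$ be its Pontryagin dual, a compact abelian group, and let $\lambda$ be the normalized Haar measure of $\widehat G$. Suppose that $\widehat G$ contains an open subgroup $U$ of bounded order, that is, there is an integer $m\ge 1$ with $\chi^m=1$ for all $\chi\in U$. For a Borel measure $\mu$ on $\widehat G$ let $\operatorname{supp}\mu$ be the set of points all of whose neighbourhoods have positive $\mu$-measure, and let $\widehat\mu(g)=\int_{\widehat G}\overline{\chi(g)}\,d\mu(\chi)$ for $g\in G$. Then there is a Borel probability measure $\mu$ on $\widehat G$ such that $\lambda(\operatorname{supp}\mu)=0$ and $\widehat\mu\in\ell^p(G)$ for all $p\in(2,\infty]$. More precisely, there are a finite abelian group $A_0$, a finite abelian group $B$ with $k:=|B|\ge 2$, and an isomorphism of topological groups $$\widehat G\;\cong\;A_0\times\prod_{n=1}^\infty\big(B^n\big)^{k^n}=\prod_{j=0}^\infty A_j$$ (finite groups being discrete and the product having the product topology), where the groups $A_j$ with $j\ge 1$ are the blocks $B^n$, the block $B^n$ occurring $k^n$ times for each $n\ge 1$, such that the measure $\mu$ with the two properties above is the one that corresponds under this isomorphism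 to the product measure $\prod_{j=0}^\infty\mu_j$, where $\mu_0$ is the uniform distribution on $A_0$ and, for $j\ge 1$, $\mu_j$ is the uniform distribution on $A_j$ without its identity element. -/

import Mathlib

open MeasureTheory ProbabilityTheory
open scoped ENNReal

/-- A group is locally finite if each of its finitely generated subgroups is finite. -/
def IsLocallyFiniteGroup (G : Type*) [Group G] : Prop :=
  ∀ s : Finset G, Finite (Subgroup.closure (s : Set G))

/-- The Haar measure of total mass one on the (compact) dual of a discrete abelian group. -/
noncomputable def dualHaar (G : Type*) [CommGroup G] [TopologicalSpace G] [DiscreteTopology G]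
    [MeasurableSpace (PontryaginDual G)] [BorelSpace (PontryaginDual G)] :
    Measure (PontryaginDual G) :=
  Measure.haarMeasure ⊤

/-- The Fourier–Stieltjes transform `g ↦ ∫ conj (χ g) dμ(χ)` of a measure on the dual of `G`. -/
noncomputable def fourierStieltjes {G : Type*} [CommGroup G] [TopologicalSpace G]
    [MeasurableSpace (PontryaginDual G)] (μ : Measure (PontryaginDual G)) (g : G) : ℂ :=
  ∫ χ : PontryaginDual G, (starRingEnd ℂ) ((χ g : Circle) : ℂ) ∂μ

/-- The uniform distribution on the set of non-identity elements of a group. -/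
noncomputable def uniformNonId (A : Type*) [Group A] [MeasurableSpace A] : Measure A :=
  uniformOn {x : A | x ≠ 1}

/-- The index set of the blocks: for each `n ≥ 1` there are `k ^ n` blocks of rank `n`.
The pair `⟨m, i⟩` stands for the `i`-th block of rank `n = m + 1`. -/
abbrev BlockIndex (k : ℕ) : Type := (m : ℕ) × Fin (k ^ (m + 1))

/-- The product `∏_{n ≥ 1} (B ^ n) ^ (k ^ n)`, where `k` is the cardinality of `B`. -/
abbrev BlockProduct (B : Type) : Type :=
  (j : BlockIndex (Nat.card B)) → (Fin (j.1 + 1) → B)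

/-- On `A₀ × ∏_{n ≥ 1} (B ^ n) ^ (k ^ n)`, the product of the uniform distribution on `A₀` and of
the uniform distributions on the non-identity elements of all the blocks `B ^ n`. -/
noncomputable def blockMeasure (A₀ B : Type) [Group A₀] [MeasurableSpace A₀]
    [Group B] [MeasurableSpace B] : Measure (A₀ × BlockProduct B) :=
  (uniformOn (Set.univ : Set A₀)).prod
    (Measure.infinitePi fun j : BlockIndex (Nat.card B) => uniformNonId (Fin (j.1 + 1) → B))

instance uniformNonId_isProbabilityMeasure (A : Type*) [Group A] [Finite A] [Nontrivial A]
    [MeasurableSpace A] [MeasurableSingletonClass A] : IsProbabilityMeasure (uniformNonId A) :=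
  isProbabilityMeasure_uniformOn (Set.toFinite _) (exists_ne (1 : A))

instance blockMeasure_isProbabilityMeasure (A₀ B : Type) [Group A₀] [Finite A₀]
    [MeasurableSpace A₀] [Group B] [Finite B] [Nontrivial B]
    [MeasurableSpace B] [MeasurableSingletonClass B] :
    IsProbabilityMeasure (blockMeasure A₀ B) := by
  unfold blockMeasure
  infer_instance

/-! Characters separate the points of `G`, so a bounded open subgroup of the dual, having finite
index, forces `G` to have bounded order. A countable group of bounded order is `A × ⨁ B` with `A`,
`B` finite (`exists_addEquiv_prod_finsupp_of_exponent`), and `B` is nontrivial since `G` is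
infinite. Dually, the dual of `G` is a finite group times countably many copies of the dual of `B`,
which can be regrouped into blocks at will.

The block sizes balance two requirements. Removing the identity from the `k ^ n` blocks of order `k
^ n` costs a Haar factor `(1 - k ^ (-n)) ^ (k ^ n) ≤ exp (-1)`, so using all ranks makes the support
null (`dualHaar_support_map_blockMeasure`). A nontrivial character of a block of rank `n` has
integral `-1 / (k ^ n - 1)`, so the sum of the `p`-th powers of the transform is at most `|A| ∏ (1 +
k ^ n (k ^ n - 1) ^ (-p))` over all blocks. This is finite once `∑ k ^ n * k ^ n * k ^ (-n p)`
converges, that is, for `p > 2` (`summable_blockWeight`). -/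

/-! ### Structure of countable abelian groups of bounded order -/

/-- In `ZMod n`, an element annihilated by the annihilator of `c` is a multiple of `c`. -/
theorem ZMod.dvd_of_annihilator_le {n : ℕ} [NeZero n] {c v : ZMod n}
    (h : ∀ r : ZMod n, r * c = 0 → r * v = 0) : c ∣ v := by
  obtain ⟨d', hd'⟩ : c.val.gcd n ∣ n := Nat.gcd_dvd_right _ _
  obtain ⟨e, he⟩ : c.val.gcd n ∣ c.val := Nat.gcd_dvd_left _ _
  set d := c.val.gcd n with hd
  have hn : 0 < n := NeZero.pos n
  have hd'0 : 0 < d' := Nat.pos_of_ne_zero (by rintro rfl; omega)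
  -- The cofactor `d'` of the gcd `d` kills `c`, hence `v`; since `n = d * d'`, this gives `d ∣ v`.
  -- Bézout gives `c ∣ d`.
  have h1 : (d' : ZMod n) * c = 0 := by
    rw [← ZMod.natCast_zmod_val c, he, ← Nat.cast_mul, ZMod.natCast_eq_zero_iff]
    exact ⟨e, by rw [hd']; ring⟩
  have h2 := h _ h1
  rw [← ZMod.natCast_zmod_val v, ← Nat.cast_mul, ZMod.natCast_eq_zero_iff] at h2
  have h3 : d ∣ v.val := by
    have h2' : d * d' ∣ d' * v.val := hd' ▸ h2
    rw [mul_comm d d'] at h2'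
    exact Nat.dvd_of_mul_dvd_mul_left hd'0 h2'
  have h4 : c ∣ (d : ZMod n) := by
    have hb := congrArg (Int.cast : ℤ → ZMod n) (Nat.gcd_eq_gcd_ab c.val n)
    push_cast at hb
    rw [ZMod.natCast_zmod_val, ZMod.natCast_self, zero_mul, add_zero] at hb
    exact ⟨_, hb⟩
  refine h4.trans ?_
  obtain ⟨w, hw⟩ := h3
  exact ⟨w, by rw [← Nat.cast_mul, ← hw, ZMod.natCast_zmod_val]⟩

/-- Free modules over `ZMod n` are injective. -/
theorem ZMod.baer_finsupp (n : ℕ) [NeZero n] (I : Type*) : Module.Baer (ZMod n) (I →₀ ZMod n) := by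
  classical
  intro J g
  have : IsPrincipalIdealRing (ZMod n) :=
    IsPrincipalIdealRing.of_surjective (Int.castRingHom (ZMod n)) (ZMod.ringHom_surjective _)
  obtain ⟨c, hc⟩ := (IsPrincipalIdealRing.principal J).principal
  have hcJ : c ∈ J := by rw [hc]; exact Submodule.mem_span_singleton_self c
  set x := g ⟨c, hcJ⟩ with hx
  have hdvd : ∀ i, c ∣ x i := by
    intro i
    apply ZMod.dvd_of_annihilator_le
    intro r hr
    have : r • x = 0 := by
      rw [hx, ← map_smul]
      convert map_zero g
      simpa using hr
    simpa using DFunLike.congr_fun this i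
  choose f hf using hdvd
  -- The quotients `f i` are arbitrary where `x i = 0`; setting them to `0` there keeps the support
  -- finite.
  let y : I →₀ ZMod n := Finsupp.onFinset x.support (fun i => if x i = 0 then 0 else f i)
    (fun i hi => by
      rw [Finsupp.mem_support_iff]
      intro h0
      simp [h0] at hi)
  have hy : c • y = x := by
    ext i
    by_cases h0 : x i = 0
    · simp [y, h0]
    · simp [y, h0, ← hf i]
  refine ⟨LinearMap.toSpanSingleton (ZMod n) _ y, fun r hr => ?_⟩
  obtain ⟨a, rfl⟩ := Submodule.mem_span_singleton.1 (hc ▸ hr)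
  have : (⟨a • c, hr⟩ : J) = a • ⟨c, hcJ⟩ := rfl
  rw [this, map_smul g, ← hx, ← hy, LinearMap.toSpanSingleton_apply, smul_eq_mul, mul_smul]

/-- A module over `ZMod n` splits as the direct sum of a free module and a module without elements
of order `n`. -/
theorem ZMod.exists_addEquiv_finsupp_prod {n : ℕ} (hn : 1 < n) (M : Type*) [AddCommGroup M]
    [Module (ZMod n) M] :
    ∃ (s : Set M) (C : AddSubgroup M), (∀ c : C, addOrderOf c ≠ n) ∧
      Nonempty (M ≃+ (s →₀ ZMod n) × C) := by
  have : NeZero n := ⟨by omega⟩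
  have : Fact (1 < n) := ⟨hn⟩
  obtain ⟨s, hs, hmax⟩ := exists_maximal_linearIndepOn' (ZMod n) (id : M → M)
  let f : (s →₀ ZMod n) →ₗ[ZMod n] M := Finsupp.linearCombination (ZMod n) (fun i : s => (i : M))
  have hf : Function.Injective f := hs
  obtain ⟨r, hr⟩ := (ZMod.baer_finsupp n s).extension_property f hf LinearMap.id
  have hrf : ∀ x, r (f x) = x := fun x => LinearMap.congr_fun hr x
  refine ⟨s, r.ker.toAddSubgroup, ?_, ⟨?_⟩⟩
  · rintro ⟨c, hc⟩ hord
    replace hc : r c = 0 := hc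
    rw [← AddSubgroup.addOrderOf_coe] at hord
    simp only at hord
    have hann : ∀ a : ZMod n, a • c = 0 → a = 0 := by
      intro a ha
      rw [← ZMod.natCast_zmod_val a, Nat.cast_smul_eq_nsmul] at ha
      have := addOrderOf_dvd_of_nsmul_eq_zero ha
      rw [hord] at this
      rw [← ZMod.natCast_zmod_val a, ZMod.natCast_eq_zero_iff]
      exact this
    have hli : LinearIndepOn (ZMod n) id ({c} : Set M) := by
      rw [linearIndepOn_iff]
      intro l hl h0
      obtain ⟨a, rfl⟩ : ∃ a, l = Finsupp.single c a := by
        refine ⟨l c, ?_⟩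
        rw [Finsupp.mem_supported] at hl
        exact Finsupp.support_subset_singleton.1 (by exact_mod_cast hl)
      rw [Finsupp.linearCombination_single] at h0
      rw [hann a h0, Finsupp.single_zero]
    -- The retraction `r` is injective on the span of `s` and vanishes on `c`. So an element `c` of
    -- order `n` could be added to the maximal independent set `s`.
    have hdis : Disjoint (Submodule.span (ZMod n) s) (Submodule.span (ZMod n) {c}) := by
      rw [Submodule.disjoint_def]
      intro x hx1 hx2
      obtain ⟨a, rfl⟩ := Submodule.mem_span_singleton.1 hx2
      have hsr : s = Set.range (fun i : s => (i : M)) := by simp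
      rw [hsr, ← Finsupp.range_linearCombination] at hx1
      obtain ⟨y, hy⟩ := hx1
      have h1 := hrf y
      rw [show f y = a • c from hy, map_smul, hc, smul_zero] at h1
      rw [← hy, ← h1, map_zero]
    have heq := hmax _ Set.subset_union_left (hs.id_union hli hdis)
    have hcs : c ∈ s := by rw [heq]; simp
    have h1 := hrf (Finsupp.single ⟨c, hcs⟩ 1)
    rw [show f (Finsupp.single ⟨c, hcs⟩ 1) = c by simp [f], hc] at h1
    have := DFunLike.congr_fun h1 ⟨c, hcs⟩
    simp at this
  · exact
      { toFun := fun m => (r m, ⟨m - f (r m), by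
          change r (m - f (r m)) = 0
          rw [map_sub, hrf, sub_self]⟩)
        invFun := fun p => f p.1 + p.2
        left_inv := fun m => by simp
        right_inv := by
          rintro ⟨x, c, hc⟩
          replace hc : r c = 0 := hc
          ext1
          · simp [hrf, hc]
          · ext
            simp [hrf, hc]
        map_add' := fun m m' => by
          ext1
          · simp
          · ext
            simp [add_sub_add_comm] }

/-- Pairs of finitely supported functions as finitely supported functions to pairs. -/
noncomputable def Finsupp.prodAddEquiv (I M N : Type*) [AddCommGroup M] [AddCommGroup N] :
    (I →₀ M) × (I →₀ N) ≃+ (I →₀ M × N) where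
  toFun p := p.1.mapRange (fun m => (m, 0)) rfl + p.2.mapRange (fun n => (0, n)) rfl
  invFun q := (q.mapRange Prod.fst rfl, q.mapRange Prod.snd rfl)
  left_inv p := by
    ext <;> simp
  right_inv q := by
    ext <;> simp
  map_add' p q := by
    ext <;> simp

/-- A countable abelian group of bounded order is `A × ⨁ B` for some finite groups
`A` and `B`. -/
theorem exists_addEquiv_prod_finsupp_of_exponent (N : ℕ) (hN : 0 < N) :
    ∀ (M : Type*) [AddCommGroup M] [Countable M], AddMonoid.exponent M = N →
    ∃ (A B : Type) (_ : AddCommGroup A) (_ : AddCommGroup B), Finite A ∧ Finite B ∧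
      Nonempty (M ≃+ A × (ℕ →₀ B)) := by
  induction N using Nat.strong_induction_on with
  | _ N ih =>
  intro M _ _ hM
  rcases Nat.lt_or_ge 1 N with h1 | h1
  · have : NeZero N := ⟨by omega⟩
    let : Module (ZMod N) M := AddCommGroup.zmodModule (fun x => hM ▸ AddMonoid.exponent_nsmul_eq_zero x)
    obtain ⟨s, C, hC, ⟨e⟩⟩ := ZMod.exists_addEquiv_finsupp_prod h1 M
    have hdvd : AddMonoid.exponent C ∣ N :=
      hM ▸ AddMonoid.exponent_dvd_of_addMonoidHom C.subtype C.subtype_injective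
    have hpos : 0 < AddMonoid.exponent C := Nat.pos_of_dvd_of_pos hdvd hN
    -- The exponent is attained as the order of an element, and `C` has none of order `N`; so the
    -- induction applies to `C`.
    have hne : AddMonoid.exponent C ≠ N := by
      obtain ⟨c, hc⟩ := AddMonoid.exists_addOrderOf_eq_exponent
        (AddMonoid.exponent_ne_zero.1 hpos.ne')
      exact hc ▸ hC c
    obtain ⟨A, B, _, _, hA, hB, ⟨e'⟩⟩ := ih _ (lt_of_le_of_ne (Nat.le_of_dvd hN hdvd) hne) hpos C rfl
    -- A free part of finite rank is absorbed into `A`, one of infinite rank into `B`.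
    rcases finite_or_infinite s with hs | hs
    · obtain ⟨m, ⟨es⟩⟩ := Finite.exists_equiv_fin s
      have : Finite (Fin m →₀ ZMod N) := Finite.of_injective _ DFunLike.coe_injective
      exact ⟨(Fin m →₀ ZMod N) × A, B, inferInstance, inferInstance, inferInstance, hB,
        ⟨e.trans (((Finsupp.domCongr es).prodCongr e').trans AddEquiv.prodAssoc.symm)⟩⟩
    · obtain ⟨es⟩ : Nonempty (s ≃ ℕ) := nonempty_equiv_of_countable
      exact ⟨A, ZMod N × B, inferInstance, inferInstance, hA, inferInstance,
        ⟨(e.trans ((Finsupp.domCongr es).prodCongr e')).trans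
          ((AddEquiv.prodAssoc.symm.trans ((AddEquiv.prodComm.prodCongr (.refl _)).trans
            AddEquiv.prodAssoc)).trans ((AddEquiv.refl A).prodCongr
              (Finsupp.prodAddEquiv ℕ (ZMod N) B)))⟩⟩
  · obtain rfl : N = 1 := by omega
    have : Subsingleton M := AddMonoid.exp_eq_one_iff.1 hM
    refine ⟨PUnit, PUnit, inferInstance, inferInstance, inferInstance, inferInstance, ⟨?_⟩⟩
    exact
      { toFun := fun _ => 0
        invFun := fun _ => 0
        left_inv := fun _ => Subsingleton.elim _ _
        right_inv := fun _ => Subsingleton.elim _ _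
        map_add' := fun _ _ => Subsingleton.elim _ _ }

/-! ### Bounded order passes from the dual to the group -/

/-- The characters of a discrete abelian group separate its points. -/
theorem PontryaginDual.exists_apply_ne_one {G : Type*} [CommGroup G] [TopologicalSpace G]
    [DiscreteTopology G] {g : G} (hg : g ≠ 1) : ∃ χ : PontryaginDual G, χ g ≠ 1 := by
  obtain ⟨c, hc⟩ := CharacterModule.exists_character_apply_ne_zero_of_ne_zero
    (A := Additive G) (a := Additive.ofMul g) hg
  -- `CharacterModule` has values in `ℚ / ℤ`; these embed into `ℝ / ℤ`, hence into the circle.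
  let q : AddCircle (1 : ℚ) →+ AddCircle (1 : ℝ) :=
    QuotientAddGroup.map _ _ (Rat.castHom ℝ).toAddMonoidHom (by
      rintro _ ⟨k, rfl⟩
      exact ⟨k, by simp⟩)
  have hq : Function.Injective q := by
    rw [injective_iff_map_eq_zero]
    intro a
    induction a using QuotientAddGroup.induction_on with
    | H a =>
      intro ha
      obtain ⟨k, hk⟩ := AddCircle.coe_eq_zero_iff (1 : ℝ) |>.1
        (show (((a : ℚ) : ℝ) : AddCircle (1 : ℝ)) = 0 from ha)
      refine (AddCircle.coe_eq_zero_iff (1 : ℚ)).2 ⟨k, ?_⟩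
      have : ((k : ℚ) : ℝ) = (a : ℝ) := by simpa using hk
      simpa using Rat.cast_injective this
  let χ : G →ₜ* Circle :=
    { toFun := fun x => AddCircle.toCircle (q (c (Additive.ofMul x)))
      map_one' := by simp
      map_mul' := fun x y => by simp [AddCircle.toCircle_add]
      continuous_toFun := continuous_of_discreteTopology }
  refine ⟨χ, fun h => hc ?_⟩
  have h' : AddCircle.toCircle (q (c (Additive.ofMul g))) =
      AddCircle.toCircle (0 : AddCircle (1 : ℝ)) := by
    rw [AddCircle.toCircle_zero]; exact h
  have := AddCircle.injective_toCircle one_ne_zero h'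
  exact hq (this.trans (map_zero q).symm :)

/-- If the dual of a discrete abelian group has an open subgroup of bounded order, then the group
has bounded order. -/
theorem exponentExists_of_isOpen_dual {G : Type*} [CommGroup G] [TopologicalSpace G]
    [DiscreteTopology G] (U : Subgroup (PontryaginDual G))
    (hU : IsOpen (U : Set (PontryaginDual G))) (hexp : Monoid.ExponentExists U) :
    Monoid.ExponentExists G := by
  obtain ⟨m, hm, hpow⟩ := hexp
  have : Finite (PontryaginDual G ⧸ U) := Subgroup.quotient_finite_of_isOpen U hU
  have : U.FiniteIndex := Subgroup.finiteIndex_of_finite_quotient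
  refine ⟨U.index * m, Nat.mul_pos (Nat.pos_of_ne_zero Subgroup.FiniteIndex.index_ne_zero) hm,
    fun g => ?_⟩
  by_contra hg
  obtain ⟨χ, hχ⟩ := PontryaginDual.exists_apply_ne_one hg
  apply hχ
  -- The index sends `χ` into `U`, and `m` kills `U`.
  have h1 : χ ^ (U.index * m) = 1 := by
    rw [pow_mul]
    exact congrArg Subtype.val (hpow ⟨χ ^ U.index, Subgroup.pow_index_mem U χ⟩)
  have h2 : ∀ n : ℕ, χ (g ^ n) = (χ ^ n) g := by
    intro n
    induction n with
    | zero => simp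
    | succ n ih => rw [pow_succ, map_mul, ih, pow_succ]; rfl
  rw [h2, h1, PontryaginDual.one_apply]

/-! ### The dual as a product of blocks -/

/-- The index set of the cyclic factors of the block product. -/
abbrev BlockCoord (k : ℕ) : Type := (j : BlockIndex k) × Fin (j.1 + 1)

theorem nonempty_equiv_blockCoord {k : ℕ} (hk : k ≠ 0) : Nonempty (ℕ ≃ BlockCoord k) := by
  have : NeZero k := ⟨hk⟩
  have : Infinite (BlockCoord k) :=
    Infinite.of_injective (fun n : ℕ => (⟨⟨n, 0⟩, 0⟩ : BlockCoord k)) fun a b h => by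
      simpa using congrArg (fun x : BlockCoord k => x.1.1) h
  exact nonempty_equiv_of_countable

section Dual

variable {G : Type*} [CommGroup G] [TopologicalSpace G] [DiscreteTopology G]
  {A B : Type} [AddCommGroup A] [AddCommGroup B]
  {κ : Type} {l : κ → Type}

/-- The character of `G ≃ A × ⨁ B` with given components. -/
noncomputable def dualOfComponents (φ : Additive G ≃+ A × (((j : κ) × l j) →₀ B))
    (p : AddChar A Circle × ((j : κ) → l j → AddChar B Circle)) : PontryaginDual G :=
  show G →ₜ* Circle from
  { toFun := fun g => p.1 (φ (.ofMul g)).1 * (φ (.ofMul g)).2.prod fun i b => p.2 i.1 i.2 b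
    map_one' := by simp
    map_mul' := fun x y => by
      classical
      rw [ofMul_mul, map_add, Prod.fst_add, Prod.snd_add, AddChar.map_add_eq_mul,
        Finsupp.prod_add_index' (by simp) (fun i b b' => AddChar.map_add_eq_mul _ _ _)]
      exact mul_mul_mul_comm _ _ _ _
    continuous_toFun := continuous_of_discreteTopology }

theorem dualOfComponents_apply (φ : Additive G ≃+ A × (((j : κ) × l j) →₀ B))
    (p : AddChar A Circle × ((j : κ) → l j → AddChar B Circle)) (g : G) :
    dualOfComponents φ p g =
      p.1 (φ (.ofMul g)).1 * (φ (.ofMul g)).2.prod fun i b => p.2 i.1 i.2 b := rfl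

/-- The dual of `A × ⨁ B` is the product of the duals. -/
noncomputable def dualMulEquiv (φ : Additive G ≃+ A × (((j : κ) × l j) →₀ B)) :
    (AddChar A Circle × ((j : κ) → l j → AddChar B Circle)) ≃* PontryaginDual G :=
  MulEquiv.mk' (Equiv.ofBijective (dualOfComponents φ) (by
    classical
    constructor
    · intro p q h
      have h' : ∀ x : A × (((j : κ) × l j) →₀ B), p.1 x.1 * x.2.prod (fun i b => p.2 i.1 i.2 b) =
          q.1 x.1 * x.2.prod (fun i b => q.2 i.1 i.2 b) := by
        intro x
        have := DFunLike.congr_fun h (φ.symm x).toMul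
        simpa [dualOfComponents_apply] using this
      ext1
      · exact AddChar.ext _ _ fun a => by simpa using h' (a, 0)
      · funext j i
        exact AddChar.ext _ _ fun b => by simpa using h' (0, Finsupp.single ⟨j, i⟩ b)
    · intro χ
      let ψ : A × (((j : κ) × l j) →₀ B) →+ Additive Circle :=
        (MonoidHom.toAdditive (χ : G →* Circle)).comp φ.symm.toAddMonoidHom
      refine ⟨⟨AddChar.toAddMonoidHomEquiv.symm (ψ.comp (AddMonoidHom.inl _ _)),
        fun j i => AddChar.toAddMonoidHomEquiv.symm ((ψ.comp (AddMonoidHom.inr _ _)).comp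
          (Finsupp.singleAddHom ⟨j, i⟩))⟩, ?_⟩
      refine PontryaginDual.ext fun g => ?_
      rw [dualOfComponents_apply]
      set x := φ (.ofMul g) with hx
      have h1 : ψ x = Additive.ofMul (χ g) := by
        simp [ψ, hx]
      have h2 : ψ x = ψ (x.1, 0) + x.2.sum fun i b => ψ (0, Finsupp.single i b) := by
        have h3 : ψ (0, x.2) = x.2.sum fun i b => ψ (0, Finsupp.single i b) := by
          conv_lhs => rw [← Finsupp.sum_single x.2]
          exact map_finsuppSum (ψ.comp (AddMonoidHom.inr A _)) x.2 _
        rw [← h3, ← map_add]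
        simp
      exact (h2.symm.trans h1 :))) (fun p q => by
    refine PontryaginDual.ext fun g => ?_
    change dualOfComponents φ (p * q) g = dualOfComponents φ p g * dualOfComponents φ q g
    simp only [dualOfComponents_apply, Prod.fst_mul, Prod.snd_mul, Pi.mul_apply, AddChar.mul_apply,
      Finsupp.prod_mul]
    exact mul_mul_mul_comm _ _ _ _)

variable [TopologicalSpace (AddChar A Circle)] [DiscreteTopology (AddChar A Circle)]
  [TopologicalSpace (AddChar B Circle)] [DiscreteTopology (AddChar B Circle)]

/-- The dual carries the topology of pointwise convergence, and evaluation at a fixed `g` involves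
only finitely many coordinates. -/
theorem continuous_dualMulEquiv (φ : Additive G ≃+ A × (((j : κ) × l j) →₀ B)) :
    Continuous (dualMulEquiv φ) := by
  have : Topology.IsEmbedding ((⇑) : (G →ₜ* Circle) → G → Circle) :=
    ContinuousMonoidHom.isClosedEmbedding_coe.isEmbedding
  refine this.continuous_iff.2 ?_
  refine continuous_pi fun g => ?_
  change Continuous fun p => dualOfComponents φ p g
  simp only [dualOfComponents_apply, Finsupp.prod]
  refine Continuous.mul ?_ (continuous_finsetProd _ fun i _ => ?_)
  · exact (continuous_of_discreteTopology (f := fun α : AddChar A Circle => α (φ (.ofMul g)).1)).comp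
      continuous_fst
  · exact (continuous_of_discreteTopology
      (f := fun β : AddChar B Circle => β ((φ (.ofMul g)).2 i))).comp
      ((continuous_apply i.2).comp ((continuous_apply i.1).comp continuous_snd))

/-- `dualMulEquiv` as an isomorphism of topological groups. -/
noncomputable def dualContinuousMulEquiv [Finite (AddChar A Circle)] [Finite (AddChar B Circle)]
    (φ : Additive G ≃+ A × (((j : κ) × l j) →₀ B)) :
    PontryaginDual G ≃ₜ* (AddChar A Circle × ((j : κ) → l j → AddChar B Circle)) :=
  ContinuousMulEquiv.symm
    { dualMulEquiv φ with
      continuous_toFun := continuous_dualMulEquiv φ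
      -- A continuous bijection from a compact space, here a product of finite groups, to a
      -- Hausdorff space is a homeomorphism.
      continuous_invFun := (Continuous.homeoOfEquivCompactToT2
        (f := (dualMulEquiv φ).toEquiv) (continuous_dualMulEquiv φ)).symm.continuous }

theorem dualContinuousMulEquiv_symm_apply [Finite (AddChar A Circle)] [Finite (AddChar B Circle)]
    (φ : Additive G ≃+ A × (((j : κ) × l j) →₀ B))
    (p : AddChar A Circle × ((j : κ) → l j → AddChar B Circle)) (g : G) :
    (dualContinuousMulEquiv φ).symm p g =
      p.1 (φ (.ofMul g)).1 * (φ (.ofMul g)).2.prod fun i b => p.2 i.1 i.2 b := rfl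

end Dual

/-! ### Haar measure of the support -/

/-- If `S` is stable under translations realizing all values of a homomorphism `π` to a finite
group, then the part of `S` off the kernel of `π` has relative measure `1 - 1 / |X|`. -/
theorem measureReal_inter_ne_one {H X : Type*} [Group H] [MeasurableSpace H] [MeasurableMul H]
    (ν : Measure H) [ν.IsMulLeftInvariant] [IsFiniteMeasure ν] [Group X] [Finite X]
    (π : H →* X) (hπ : ∀ a, MeasurableSet (π ⁻¹' {a})) {S : Set H} (hS : MeasurableSet S)
    (h : ∀ a, ∃ u, π u = a ∧ ∀ x, u * x ∈ S ↔ x ∈ S) :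
    ν.real (S ∩ {x | π x ≠ 1}) = (1 - (Nat.card X : ℝ)⁻¹) * ν.real S := by
  classical
  have := Fintype.ofFinite X
  have hmeas : ∀ a, MeasurableSet (S ∩ π ⁻¹' {a}) := fun a => hS.inter (hπ a)
  have hc : ∀ a, ν.real (S ∩ π ⁻¹' {a}) = ν.real (S ∩ π ⁻¹' {1}) := by
    intro a
    obtain ⟨u, hu, hus⟩ := h a
    have : (fun x => u * x) ⁻¹' (S ∩ π ⁻¹' {a}) = S ∩ π ⁻¹' {1} := by
      ext x
      simp [hus, hu]
    rw [← this, measureReal_def, measureReal_def, measure_preimage_mul]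
  have hsum : ν.real S = Nat.card X * ν.real (S ∩ π ⁻¹' {1}) := by
    have hU : S = ⋃ a ∈ (Finset.univ : Finset X), S ∩ π ⁻¹' {a} := by
      ext x
      simp
    conv_lhs => rw [hU]
    rw [measureReal_biUnion_finset _ (fun a _ => hmeas a)]
    · simp [hc]
    · intro a _ b _ hab
      refine Set.disjoint_left.2 fun x hx hx' => hab ?_
      exact hx.2.symm.trans hx'.2
  have hdiff : S ∩ {x | π x ≠ 1} = S \ (S ∩ π ⁻¹' {1}) := by
    ext x
    simp
  rw [hdiff, measureReal_sdiff Set.inter_subset_left (hmeas 1), hsum]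
  have : (Nat.card X : ℝ) ≠ 0 := by exact_mod_cast Nat.card_pos.ne'
  field_simp

/-- The invariant measure of the set of points of a product of finite groups all of whose
coordinates in a finite set are nontrivial. -/
theorem measureReal_forall_ne_one {K A₀ κ : Type*} {X : κ → Type*} [Group K] [MeasurableSpace K]
    [MeasurableMul K] (ν : Measure K) [ν.IsMulLeftInvariant] [IsProbabilityMeasure ν]
    [Group A₀] [∀ j, Group (X j)] [∀ j, Finite (X j)] (e : K ≃* A₀ × ((j : κ) → X j))
    (he : ∀ j a, MeasurableSet {x | (e x).2 j = a}) (s : Finset κ) :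
    ν.real {x | ∀ j ∈ s, (e x).2 j ≠ 1} = ∏ j ∈ s, (1 - (Nat.card (X j) : ℝ)⁻¹) := by
  classical
  have hms : ∀ s : Finset κ, MeasurableSet {x | ∀ j ∈ s, (e x).2 j ≠ 1} := by
    intro s
    have : {x | ∀ j ∈ s, (e x).2 j ≠ 1} = ⋂ j ∈ s, {x | (e x).2 j = 1}ᶜ := by
      ext x
      simp
    rw [this]
    exact s.measurableSet_biInter fun j _ => (he j 1).compl
  induction s using Finset.induction_on with
  | empty => simp
  | insert j s hj ih =>
    rw [Finset.prod_insert hj, ← ih]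
    let π : K →* X j :=
      ((Pi.evalMonoidHom X j).comp (MonoidHom.snd A₀ _)).comp e.toMonoidHom
    rw [← measureReal_inter_ne_one ν π (fun a => he j a) (hms s)]
    · congr 1
      ext x
      simp [π, and_comm]
    · intro a
      -- Translation by an element living in coordinate `j ∉ s` leaves the conditions on `s`
      -- unchanged.
      refine ⟨e.symm (1, Pi.mulSingle j a), by simp [π], fun x => ?_⟩
      refine forall₂_congr fun i hi => ?_
      have : i ≠ j := fun h => hj (h ▸ hi)
      simp [Pi.mulSingle_eq_of_ne this]

instance dualHaar_isHaarMeasure (G : Type*) [CommGroup G] [TopologicalSpace G] [DiscreteTopology G]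
    [MeasurableSpace (PontryaginDual G)] [BorelSpace (PontryaginDual G)] :
    (dualHaar G).IsHaarMeasure := by
  unfold dualHaar
  infer_instance

instance dualHaar_isProbabilityMeasure (G : Type*) [CommGroup G] [TopologicalSpace G]
    [DiscreteTopology G] [MeasurableSpace (PontryaginDual G)] [BorelSpace (PontryaginDual G)] :
    IsProbabilityMeasure (dualHaar G) :=
  ⟨by simpa [dualHaar] using Measure.haarMeasure_self (K₀ := (⊤ : TopologicalSpace.PositiveCompacts
    (PontryaginDual G)))⟩

theorem uniformNonId_singleton_one (A : Type*) [Group A] [Finite A] [MeasurableSpace A]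
    [MeasurableSingletonClass A] : uniformNonId A {1} = 0 := by
  rw [uniformNonId, uniformOn_eq_zero_iff (Set.toFinite _)]
  ext x
  simp +contextual

section Support

variable {G : Type*} [CommGroup G] [TopologicalSpace G]
  [MeasurableSpace (PontryaginDual G)] [BorelSpace (PontryaginDual G)]
  {A₀ B : Type} [CommGroup A₀] [TopologicalSpace A₀] [DiscreteTopology A₀]
  [MeasurableSpace A₀] [DiscreteMeasurableSpace A₀]
  [CommGroup B] [Finite B] [Nontrivial B] [TopologicalSpace B] [DiscreteTopology B]
  [MeasurableSpace B] [DiscreteMeasurableSpace B]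

/-- The set on the right is closed, and its complement is null because the `j`-th marginal gives the
identity no mass. -/
theorem support_map_blockMeasure_subset (e : PontryaginDual G ≃ₜ* (A₀ × BlockProduct B))
    (j : BlockIndex (Nat.card B)) :
    ((blockMeasure A₀ B).map e.symm).support ⊆ {x | (e x).2 j ≠ 1} := by
  have hcont : Continuous fun x => (e x).2 j :=
    (continuous_apply j).comp (continuous_snd.comp e.continuous)
  refine Measure.support_subset_of_isClosed ((isClosed_discrete {1}ᶜ).preimage hcont) ?_
  rw [mem_ae_iff]
  change (blockMeasure A₀ B).map e.symm ((fun x => (e x).2 j) ⁻¹' {1}ᶜ)ᶜ = 0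
  rw [Measure.map_apply (show Measurable e.symm from e.symm.continuous.measurable)
    ((isOpen_discrete {1}ᶜ).preimage hcont).measurableSet.compl]
  have : e.symm ⁻¹' ((fun x => (e x).2 j) ⁻¹' {1}ᶜ)ᶜ =
      Set.univ ×ˢ ((fun y : BlockProduct B => y j) ⁻¹' {1}) := by
    ext y
    simp
  rw [this, blockMeasure, Measure.prod_prod, ← Measure.map_apply (measurable_pi_apply j)
    (MeasurableSet.singleton _), Measure.infinitePi_map_eval, uniformNonId_singleton_one, mul_zero]

theorem dualHaar_support_map_blockMeasure [DiscreteTopology G] [Finite A₀]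
    (e : PontryaginDual G ≃ₜ* (A₀ × BlockProduct B)) :
    dualHaar G ((blockMeasure A₀ B).map e.symm).support = 0 := by
  rw [← measureReal_eq_zero_iff]
  refine le_antisymm ?_ measureReal_nonneg
  have key : ∀ M : ℕ, (dualHaar G).real ((blockMeasure A₀ B).map e.symm).support ≤
      Real.exp (-(M : ℝ)) := by
    intro M
    -- All blocks of ranks `1` to `M`. Each rank adds `k ^ n * k ^ (-n) = 1` to the exponent below,
    -- whence `exp (-M)`.
    let s : Finset (BlockIndex (Nat.card B)) := (Finset.range M).sigma fun _ => Finset.univ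
    have hle : (dualHaar G).real ((blockMeasure A₀ B).map e.symm).support ≤
        (dualHaar G).real {x | ∀ j ∈ s, (e.toMulEquiv x).2 j ≠ 1} :=
      measureReal_mono fun x hx j _ => support_map_blockMeasure_subset e j hx
    refine hle.trans ?_
    rw [measureReal_forall_ne_one (dualHaar G) e.toMulEquiv _ s]
    · calc ∏ j ∈ s, (1 - (Nat.card (Fin (j.1 + 1) → B) : ℝ)⁻¹)
          ≤ ∏ j ∈ s, Real.exp (-(Nat.card (Fin (j.1 + 1) → B) : ℝ)⁻¹) := by
            refine Finset.prod_le_prod (fun j _ => ?_) fun j _ => Real.one_sub_le_exp_neg _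
            rw [sub_nonneg]
            exact inv_le_one_of_one_le₀ (by exact_mod_cast Nat.card_pos)
        _ = Real.exp (-(M : ℝ)) := by
            rw [← Real.exp_sum, Finset.sum_sigma]
            congr 1
            have : (Nat.card B : ℝ) ≠ 0 := by exact_mod_cast Nat.card_pos.ne'
            simp [Nat.card_fun, this]
    · intro j a
      have hcont : Continuous fun x => (e x).2 j :=
        (continuous_apply j).comp (continuous_snd.comp e.continuous)
      exact ((isOpen_discrete {a}).preimage hcont).measurableSet
  exact ge_of_tendsto' (Real.tendsto_exp_neg_atTop_nhds_zero.comp tendsto_natCast_atTop_atTop) key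

end Support

/-! ### Fourier transform of the block measure -/

/-- The integral of a nontrivial character against the uniform distribution on the non-identity
elements. -/
theorem integral_uniformNonId {X : Type*} [CommGroup X] [Finite X] [MeasurableSpace X]
    [MeasurableSingletonClass X] (f : X →* ℂ) (hf : f ≠ 1) :
    ∫ x, f x ∂(uniformNonId X) = -((Nat.card X : ℂ) - 1)⁻¹ := by
  classical
  have := Fintype.ofFinite X
  have hnt : Nontrivial X := by
    by_contra h
    rw [not_nontrivial_iff_subsingleton] at h
    exact hf (MonoidHom.ext fun x => by rw [Subsingleton.elim x 1, map_one, map_one])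
  have hone : ∀ x : X, x ≠ 1 →
      (uniformNonId X).real {x} = ((Nat.card X : ℝ) - 1)⁻¹ := by
    intro x hx
    have hs : {x : X | x ≠ 1} = ((Finset.univ.erase (1 : X) : Finset X) : Set X) := by
      ext; simp
    rw [uniformNonId, hs, measureReal_def, ← Finset.coe_singleton, uniformOn_apply_finset]
    have : (Finset.univ.erase (1 : X)) ∩ {x} = {x} := by
      ext y; simp only [Finset.mem_inter, Finset.mem_erase, Finset.mem_singleton]; grind
    rw [this, Finset.card_erase_of_mem (Finset.mem_univ _), Finset.card_univ,
      Fintype.card_eq_nat_card, ENNReal.toReal_div, ENNReal.toReal_natCast, ENNReal.toReal_natCast,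
      Finset.card_singleton, Nat.cast_sub Nat.card_pos]
    simp
  have hzero : (uniformNonId X).real {1} = 0 := by
    rw [measureReal_def, uniformNonId_singleton_one, ENNReal.toReal_zero]
  rw [integral_fintype .of_finite]
  -- A nontrivial character sums to zero, so its values off the identity sum to `-1`.
  have hsum := sum_hom_units_eq_zero f hf
  rw [← Finset.add_sum_erase _ _ (Finset.mem_univ (1 : X)), map_one] at hsum
  rw [← Finset.add_sum_erase _ _ (Finset.mem_univ (1 : X)), hzero, zero_smul, zero_add,
    Finset.sum_congr rfl fun x hx => by rw [hone x (Finset.ne_of_mem_erase hx)],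
    ← Finset.smul_sum, eq_neg_of_add_eq_zero_right hsum]
  simp

theorem integral_infinitePi_finsetProd {κ : Type*} {X : κ → Type*} [∀ j, MeasurableSpace (X j)]
    (ν : (j : κ) → Measure (X j)) [∀ j, IsProbabilityMeasure (ν j)] (J : Finset κ)
    (f : (j : κ) → X j → ℂ) (hf : ∀ j, Measurable (f j)) :
    ∫ x, ∏ j ∈ J, f j (x j) ∂(Measure.infinitePi ν) = ∏ j ∈ J, ∫ x, f j x ∂(ν j) := by
  have h := integral_restrict_infinitePi (μ := ν) (s := J)
    (f := fun y : (j : J) → X j => ∏ j : J, f j (y j))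
    (Finset.measurable_fun_prod _ fun (j : J) _ =>
      (hf j).comp (measurable_pi_apply j)).aestronglyMeasurable
  rw [integral_fintype_prod_eq_prod (fun j : J => f j), Finset.prod_coe_sort J
    (fun j => ∫ x, f j x ∂(ν j))] at h
  rw [← h]
  refine integral_congr_ae (.of_forall fun x => ?_)
  exact (Finset.prod_coe_sort J (fun j => f j (x j))).symm

theorem AddChar.exists_circle_apply_ne_one {B : Type*} [AddCommGroup B] [Finite B] {b : B}
    (hb : b ≠ 0) : ∃ β : AddChar B Circle, β b ≠ 1 := by
  obtain ⟨β, hβ⟩ := AddChar.exists_apply_ne_zero.2 hb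
  refine ⟨AddChar.circleEquivComplex.symm β, fun h => hβ ?_⟩
  exact congrArg Circle.coeHom h

/-- The blocks are powers of the dual of `B`, while the coordinates of `g` lie in `B`; equality of
the orders lets one `k` serve both. -/
theorem AddChar.natCard_circle (B : Type*) [AddCommGroup B] [Finite B] :
    Nat.card (AddChar B Circle) = Nat.card B := by
  have := Fintype.ofFinite B
  have : Fintype (AddChar B ℂ) := Fintype.ofFinite _
  rw [Nat.card_congr AddChar.circleEquivComplex.toEquiv, ← Fintype.card_eq_nat_card,
    ← Fintype.card_eq_nat_card, AddChar.card_eq]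

/-- The blocks in which an element of `⨁ B` has a nonzero coordinate. -/
noncomputable def blockSupport {k : ℕ} {B : Type} [AddCommGroup B] (b : BlockCoord k →₀ B) : Finset (BlockIndex k) :=
  open scoped Classical in b.support.image Sigma.fst

theorem mem_blockSupport {k : ℕ} {B : Type} [AddCommGroup B] {b : BlockCoord k →₀ B} {j : BlockIndex k} :
    j ∈ blockSupport b ↔ ∃ i, b ⟨j, i⟩ ≠ 0 := by
  classical
  simp only [blockSupport, Finset.mem_image, Finsupp.mem_support_iff]
  constructor
  · rintro ⟨⟨j, i⟩, h, rfl⟩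
    exact ⟨i, h⟩
  · rintro ⟨i, h⟩
    exact ⟨⟨j, i⟩, h, rfl⟩

/-- The conjugate of the evaluation of a tuple of characters at a tuple of group elements. -/
noncomputable def conjPairing {n : ℕ} {B : Type} [AddCommGroup B] (b : Fin n → B) : (Fin n → AddChar B Circle) →* ℂ where
  toFun x := ∏ i, (starRingEnd ℂ) ((x i (b i) : Circle) : ℂ)
  map_one' := by simp
  map_mul' x y := by simp [Finset.prod_mul_distrib]

theorem conjPairing_ne_one {n : ℕ} {B : Type} [AddCommGroup B] [Finite B] {b : Fin n → B} {i : Fin n} (hb : b i ≠ 0) :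
    conjPairing b ≠ 1 := by
  classical
  obtain ⟨β, hβ⟩ := AddChar.exists_circle_apply_ne_one hb
  intro h
  have := DFunLike.congr_fun h (Pi.mulSingle i β)
  rw [conjPairing, MonoidHom.coe_mk, OneHom.coe_mk,
    Finset.prod_eq_single i (fun i' _ hi' => by simp [Pi.mulSingle_eq_of_ne hi']) (by simp)] at this
  rw [Pi.mulSingle_eq_same, MonoidHom.one_apply, ← map_one (starRingEnd ℂ)] at this
  exact hβ (Circle.ext (by simpa using (starRingEnd ℂ).injective this))

section Fourier

variable {G : Type*} [CommGroup G] [TopologicalSpace G] [DiscreteTopology G]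
  [MeasurableSpace (PontryaginDual G)] [BorelSpace (PontryaginDual G)]
  {A B : Type} [AddCommGroup A] [AddCommGroup B] [Finite B]
  [Finite (AddChar A Circle)] [TopologicalSpace (AddChar A Circle)]
  [DiscreteTopology (AddChar A Circle)]
  [MeasurableSpace (AddChar A Circle)] [DiscreteMeasurableSpace (AddChar A Circle)]
  [Finite (AddChar B Circle)] [Nontrivial (AddChar B Circle)]
  [TopologicalSpace (AddChar B Circle)] [DiscreteTopology (AddChar B Circle)]
  [MeasurableSpace (AddChar B Circle)] [DiscreteMeasurableSpace (AddChar B Circle)]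

/-- The integral factors over `A` and the blocks. The factor at `A` has norm at most `1`, blocks
where `g` has only zero coordinates contribute `1`, and every other block contributes exactly its
weight in norm. -/
theorem norm_fourierStieltjes_map_blockMeasure_le
    (φ : Additive G ≃+ A × (BlockCoord (Nat.card (AddChar B Circle)) →₀ B)) (g : G) :
    ‖fourierStieltjes ((blockMeasure (AddChar A Circle) (AddChar B Circle)).map
      (dualContinuousMulEquiv φ).symm) g‖ ≤
      ∏ j ∈ blockSupport (φ (.ofMul g)).2, ((Nat.card B : ℝ) ^ (j.1 + 1) - 1)⁻¹ := by
  classical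
  set a := (φ (.ofMul g)).1 with ha
  set b := (φ (.ofMul g)).2 with hb
  have hmeas : Measurable fun χ : PontryaginDual G => (starRingEnd ℂ) ((χ g : Circle) : ℂ) := by
    have : Continuous fun χ : PontryaginDual G => χ g :=
      (continuous_apply g).comp
        (ContinuousMonoidHom.isClosedEmbedding_coe (A := G) (B := Circle)).continuous
    exact (Complex.continuous_conj.comp (continuous_subtype_val.comp this)).measurable
  have hval : ∀ p : AddChar A Circle × BlockProduct (AddChar B Circle),
      (starRingEnd ℂ) (((dualContinuousMulEquiv φ).symm p g : Circle) : ℂ) =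
        (starRingEnd ℂ) ((p.1 a : Circle) : ℂ) *
          ∏ j ∈ blockSupport b, conjPairing (fun i => b ⟨j, i⟩) (p.2 j) := by
    intro p
    -- The product over the support is extended to full blocks; the added coordinates are zero and
    -- contribute `1`.
    rw [dualContinuousMulEquiv_symm_apply, ← ha, ← hb,
      Finsupp.prod_of_support_subset b (s := (blockSupport b).sigma fun _ => Finset.univ)
        _ _ (by simp), Finset.prod_sigma]
    · simp only [conjPairing, MonoidHom.coe_mk, OneHom.coe_mk, map_mul, Circle.coe_mul]
      congr 1
      exact (map_prod ((starRingEnd ℂ).toMonoidHom.comp Circle.coeHom) _ _).trans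
        (Finset.prod_congr rfl fun j _ =>
          map_prod ((starRingEnd ℂ).toMonoidHom.comp Circle.coeHom) _ _)
    · intro i hi
      rw [Finset.mem_sigma]
      exact ⟨mem_blockSupport.2 ⟨i.2, Finsupp.mem_support_iff.1 hi⟩, Finset.mem_univ _⟩
  have hsymm : Measurable (dualContinuousMulEquiv φ).symm :=
    (dualContinuousMulEquiv φ).symm.continuous.measurable
  rw [fourierStieltjes, integral_map hsymm.aemeasurable
    hmeas.aestronglyMeasurable]
  simp only [hval]
  rw [blockMeasure, integral_prod_mul (fun x : AddChar A Circle => (starRingEnd ℂ) ((x a : Circle) : ℂ))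
      (fun y : BlockProduct (AddChar B Circle) =>
        ∏ j ∈ blockSupport b, conjPairing (fun i => b ⟨j, i⟩) (y j)),
    integral_infinitePi_finsetProd _ _
      (fun j x => conjPairing (fun i => b ⟨j, i⟩) x) (fun j => .of_discrete), norm_mul, norm_prod]
  have : IsProbabilityMeasure (uniformOn (Set.univ : Set (AddChar A Circle))) :=
    isProbabilityMeasure_uniformOn Set.finite_univ Set.univ_nonempty
  have h1 : ‖∫ x : AddChar A Circle, (starRingEnd ℂ) ((x a : Circle) : ℂ)
      ∂(uniformOn Set.univ)‖ ≤ 1 := by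
    refine (norm_integral_le_of_norm_le_const (C := 1) (.of_forall fun x =>
      (by simpa using (Circle.norm_coe (x a)).le))).trans ?_
    simp
  refine (mul_le_of_le_one_left (Finset.prod_nonneg fun _ _ => norm_nonneg _) h1).trans ?_
  refine (Finset.prod_congr rfl fun j hj => ?_).le
  obtain ⟨i, hi⟩ := mem_blockSupport.1 hj
  have hcard : ∀ n, Nat.card (Fin n → AddChar B Circle) = Nat.card B ^ n := fun n => by
    rw [Nat.card_fun, AddChar.natCard_circle, Nat.card_eq_fintype_card (α := Fin n),
      Fintype.card_fin]
  rw [integral_uniformNonId _ (conjPairing_ne_one (b := fun i => b ⟨j, i⟩) hi), norm_neg, norm_inv,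
    hcard]
  have hB : (1 : ℝ) ≤ (Nat.card B : ℝ) ^ (j.1 + 1) :=
    one_le_pow₀ (by exact_mod_cast Nat.card_pos)
  have : (((Nat.card B ^ (j.1 + 1) : ℕ) : ℂ) - 1) = (((Nat.card B : ℝ) ^ (j.1 + 1) - 1 : ℝ) : ℂ) := by
    push_cast; rfl
  rw [this, Complex.norm_real, Real.norm_of_nonneg (by linarith)]

end Fourier

/-! ### Summability for exponents above two -/

/-- With `n = m + 1`, there are `k ^ n` blocks of rank `n` with `k ^ n` contents each, so the sum is
dominated by a geometric series of ratio `k ^ (2 - p)`, which is below `1` because `p > 2`. -/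
theorem summable_blockWeight {k : ℕ} (hk : 2 ≤ k) {p : ℝ} (hp : 2 < p) {B : Type} [Finite B]
    (hB : Nat.card B = k) :
    Summable fun x : (j : BlockIndex k) × (Fin (j.1 + 1) → B) =>
      (((k : ℝ) ^ (x.1.1 + 1) - 1)⁻¹) ^ p := by
  have := Fintype.ofFinite B
  have hk' : (2 : ℝ) ≤ k := by exact_mod_cast hk
  have hk0 : (0 : ℝ) < k := by linarith
  have hpow : ∀ m : ℕ, (2 : ℝ) ≤ (k : ℝ) ^ (m + 1) := fun m =>
    hk'.trans (le_self_pow₀ (by linarith) (Nat.succ_ne_zero m))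
  have hw : ∀ m : ℕ, 0 ≤ ((k : ℝ) ^ (m + 1) - 1)⁻¹ := fun m =>
    inv_nonneg.2 (by linarith [hpow m])
  have hnn : ∀ m : ℕ, 0 ≤ (((k : ℝ) ^ (m + 1) - 1)⁻¹) ^ p := fun m => Real.rpow_nonneg (hw m) p
  rw [summable_sigma_of_nonneg fun x => hnn _]
  refine ⟨fun j => Summable.of_finite, ?_⟩
  rw [summable_sigma_of_nonneg fun x => tsum_nonneg fun _ => hnn _]
  refine ⟨fun m => Summable.of_finite, ?_⟩
  have hcardB : (Fintype.card B : ℝ) = k := by rw [Fintype.card_eq_nat_card, hB]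
  simp only [tsum_fintype, Finset.sum_const, Finset.card_univ, Fintype.card_fun, Fintype.card_fin,
    nsmul_eq_mul, Nat.cast_pow, hcardB]
  have hr : Summable fun m : ℕ => (2 : ℝ) ^ p * ((k : ℝ) ^ (2 - p)) ^ (m + 1) :=
    ((summable_nat_add_iff 1).2 (summable_geometric_of_lt_one (by positivity)
      (Real.rpow_lt_one_of_one_lt_of_neg (by linarith) (by linarith)))).mul_left _
  refine hr.of_nonneg_of_le (fun m => ?_) fun m => ?_
  · exact mul_nonneg (by positivity) (mul_nonneg (by positivity) (hnn m))
  -- Since `k ^ (m + 1) ≥ 2`, subtracting `1` at most halves it.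
  · have h1 : ((k : ℝ) ^ (m + 1) - 1)⁻¹ ≤ 2 / (k : ℝ) ^ (m + 1) := by
      rw [inv_le_comm₀ (by linarith [hpow m]) (by positivity), inv_div]
      linarith [hpow m]
    have h2 : (((k : ℝ) ^ (m + 1) - 1)⁻¹) ^ p ≤ 2 ^ p / ((k : ℝ) ^ p) ^ (m + 1) := by
      refine (Real.rpow_le_rpow (hw m) h1 (by linarith)).trans_eq ?_
      rw [Real.div_rpow (by norm_num) (by positivity), ← Real.rpow_natCast, ← Real.rpow_mul hk0.le,
        mul_comm, Real.rpow_mul hk0.le, Real.rpow_natCast]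
    calc (k : ℝ) ^ (m + 1) * ((k : ℝ) ^ (m + 1) * (((k : ℝ) ^ (m + 1) - 1)⁻¹) ^ p)
        ≤ (k : ℝ) ^ (m + 1) * ((k : ℝ) ^ (m + 1) * (2 ^ p / ((k : ℝ) ^ p) ^ (m + 1))) := by
          gcongr
      _ = 2 ^ p * ((k : ℝ) ^ (2 - p)) ^ (m + 1) := by
          rw [Real.rpow_sub hk0, Real.rpow_ofNat, div_pow, ← pow_mul]
          ring

/-- The blocks with a nonzero coordinate, together with their contents. -/
noncomputable def blockRows {k : ℕ} {B : Type} [AddCommGroup B] (b : BlockCoord k →₀ B) :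
    Finset ((j : BlockIndex k) × (Fin (j.1 + 1) → B)) :=
  (blockSupport b).map ⟨fun j => ⟨j, fun i => b ⟨j, i⟩⟩, fun _ _ h => congrArg Sigma.fst h⟩

/-- Every nonzero coordinate can be read off from the row of its block. The injection turns a sum
over `⨁ B` into part of a sum over finite sets of rows. -/
theorem blockRows_injective {k : ℕ} {B : Type} [AddCommGroup B] :
    Function.Injective (blockRows : (BlockCoord k →₀ B) → _) := by
  have key : ∀ b b' : BlockCoord k →₀ B, blockRows b = blockRows b' →
      ∀ i, b i ≠ 0 → b i = b' i := by
    rintro b b' h ⟨j, i⟩ hi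
    have hmem : (⟨j, fun i => b ⟨j, i⟩⟩ : (j : BlockIndex k) × (Fin (j.1 + 1) → B)) ∈
        blockRows b' := by
      rw [← h]
      exact Finset.mem_map_of_mem _ (mem_blockSupport.2 ⟨i, hi⟩)
    obtain ⟨j', _, hj'⟩ := Finset.mem_map.1 hmem
    obtain rfl : j' = j := congrArg Sigma.fst hj'
    exact congrFun (eq_of_heq (Sigma.mk.inj hj').2).symm i
  intro b b' h
  ext i
  by_cases hi : b i = 0
  · by_cases hi' : b' i = 0
    · rw [hi, hi']
    · exact (key b' b h.symm i hi').symm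
  · exact key b b' h i hi

/-- The sum over finite sets `s` of `∏ y ∈ s, w y` expands `∏ (1 + w y)`, which converges with `∑ w
y`; the finite factor `A` only multiplies it by `|A|`. -/
theorem summable_prod_finsetProd {A B : Type*} [Finite A]
    {w : B → ℝ} (hw0 : ∀ x, 0 ≤ w x) (hw : Summable w) :
    Summable fun x : A × Finset B => ∏ y ∈ x.2, w y := by
  have hw' : Summable fun s : Finset B => ∏ y ∈ s, w y :=
    summable_finsetProd_of_summable_nonneg hw0 hw
  rw [← (Equiv.prodComm _ _).summable_iff]
  have h0 : ∀ s : Finset B, 0 ≤ ∏ y ∈ s, w y := fun s => Finset.prod_nonneg fun x _ => hw0 x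
  refine (summable_prod_of_nonneg fun x => h0 x.1).2 ⟨fun s => Summable.of_finite, ?_⟩
  have := Fintype.ofFinite A
  simpa using hw'.mul_left (Fintype.card A : ℝ)

theorem summable_rpow_of_norm_le_prod {G A : Type*} {B : Type} [AddCommGroup B] [Finite A]
    [Finite B] [Nontrivial B] {k : ℕ} (hk : Nat.card B = k) {φ : G → A × (BlockCoord k →₀ B)}
    (hφ : Function.Injective φ) {f : G → ℂ}
    (hf : ∀ g, ‖f g‖ ≤ ∏ j ∈ blockSupport (φ g).2, ((Nat.card B : ℝ) ^ (j.1 + 1) - 1)⁻¹)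
    {p : ℝ} (hp : 2 < p) : Summable fun g => ‖f g‖ ^ p := by
  have hk2 : 2 ≤ k := by rw [← hk]; exact Finite.one_lt_card
  have hw0 : ∀ m : ℕ, 0 ≤ ((k : ℝ) ^ (m + 1) - 1)⁻¹ := fun m =>
    inv_nonneg.2 (sub_nonneg.2 (one_le_pow₀ (Nat.one_le_cast.2 (one_le_two.trans hk2))))
  let w : (j : BlockIndex k) × (Fin (j.1 + 1) → B) → ℝ :=
    fun x => (((k : ℝ) ^ (x.1.1 + 1) - 1)⁻¹) ^ p
  have hA : Summable fun x : A × Finset ((j : BlockIndex k) × (Fin (j.1 + 1) → B)) =>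
      ∏ y ∈ x.2, w y :=
    summable_prod_finsetProd (fun x => Real.rpow_nonneg (hw0 x.1.1) p)
      (summable_blockWeight hk2 hp hk)
  have hinj : Function.Injective fun g => ((φ g).1, blockRows (φ g).2) := fun g g' h =>
    hφ (Prod.ext (Prod.mk.inj h).1 (blockRows_injective (Prod.mk.inj h).2))
  have hG : Summable fun g => ∏ y ∈ blockRows (φ g).2, w y := by
    have h := hA.comp_injective hinj
    simpa only [Function.comp_def] using h
  have hle : ∀ g, ‖f g‖ ^ p ≤ ∏ y ∈ blockRows (φ g).2, w y := by
    intro g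
    refine (Real.rpow_le_rpow (norm_nonneg _) (hf g) (by linarith)).trans_eq ?_
    rw [hk, ← Real.finsetProd_rpow _ _ fun j _ => hw0 _, blockRows, Finset.prod_map]
    rfl
  exact hG.of_nonneg_of_le (fun g => Real.rpow_nonneg (norm_nonneg _) _) hle

/-- A function on `A × ⨁ B` dominated by the product of the block weights is in `ℓ^p` for all
`p > 2`. -/
theorem memℓp_of_norm_le_prod {G A : Type*} {B : Type} [AddCommGroup B] [Finite A] [Finite B]
    [Nontrivial B] {k : ℕ} (hk : Nat.card B = k) {φ : G → A × (BlockCoord k →₀ B)}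
    (hφ : Function.Injective φ) {f : G → ℂ}
    (hf : ∀ g, ‖f g‖ ≤ ∏ j ∈ blockSupport (φ g).2, ((Nat.card B : ℝ) ^ (j.1 + 1) - 1)⁻¹)
    {p : ℝ≥0∞} (hp : 2 < p) : Memℓp (E := fun _ : G => ℂ) f p := by
  have key : ∀ q : ℝ≥0∞, 2 < q → q ≠ ⊤ → Memℓp (E := fun _ : G => ℂ) f q := by
    intro q hq hqt
    refine memℓp_gen (summable_rpow_of_norm_le_prod hk hφ hf ?_)
    rw [← ENNReal.toReal_ofNat 2]
    exact (ENNReal.toReal_lt_toReal ENNReal.ofNat_ne_top hqt).2 hq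
  by_cases hpt : p = ⊤
  · rw [hpt]
    -- Any finite exponent above `2` serves here, as `ℓ^3 ⊆ ℓ^∞`.
    exact (key 3 (by norm_num) ENNReal.ofNat_ne_top).of_exponent_ge le_top
  · exact key p hp hpt

/-! ### Assembly -/

/-- The parameter `k` is quantified after `B` because it will be the order of the dual of `B`; any
`k ≠ 0` gives a countably infinite coordinate set. -/
theorem exists_addEquiv_prod_blockCoord {G : Type*} [CommGroup G] [Countable G] [Infinite G]
    (hexp : Monoid.ExponentExists G) :
    ∃ (A B : Type) (_ : AddCommGroup A) (_ : AddCommGroup B), Finite A ∧ Finite B ∧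
      Nontrivial B ∧ ∀ k, k ≠ 0 → Nonempty (Additive G ≃+ A × (BlockCoord k →₀ B)) := by
  have hexp' : AddMonoid.exponent (Additive G) ≠ 0 := AddMonoid.exponent_ne_zero.2 hexp
  have : Countable (Additive G) := ‹Countable G›
  obtain ⟨A, B, _, _, hA, hB, ⟨φ⟩⟩ := exists_addEquiv_prod_finsupp_of_exponent _
    (Nat.pos_of_ne_zero hexp') (Additive G) rfl
  refine ⟨A, B, inferInstance, inferInstance, hA, hB, ?_, fun k hk => ?_⟩
  · by_contra h
    rw [not_nontrivial_iff_subsingleton] at h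
    have : Finite (Additive G) := Finite.of_equiv _ φ.symm.toEquiv
    exact not_finite (Additive G)
  · obtain ⟨u⟩ := nonempty_equiv_blockCoord hk
    exact ⟨φ.trans ((AddEquiv.refl A).prodCongr (Finsupp.domCongr u))⟩

theorem mainTheorem5 {G : Type*} [CommGroup G] [TopologicalSpace G] [DiscreteTopology G]
    [Countable G] [Infinite G] (hG : IsLocallyFiniteGroup G)
    [MeasurableSpace (PontryaginDual G)] [BorelSpace (PontryaginDual G)]
    (hbdd : ∃ U : Subgroup (PontryaginDual G),
      IsOpen (U : Set (PontryaginDual G)) ∧ Monoid.ExponentExists U) :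
    ∃ μ : Measure (PontryaginDual G),
      IsProbabilityMeasure μ ∧
      dualHaar G μ.support = 0 ∧
      (∀ p : ℝ≥0∞, 2 < p → Memℓp (E := fun _ : G => ℂ) (fourierStieltjes μ) p) ∧
      ∃ (A₀ : Type) (_ : CommGroup A₀) (_ : Finite A₀)
        (_ : TopologicalSpace A₀) (_ : DiscreteTopology A₀)
        (_ : MeasurableSpace A₀) (_ : DiscreteMeasurableSpace A₀)
        (B : Type) (_ : CommGroup B) (_ : Finite B) (_ : Nontrivial B)
        (_ : TopologicalSpace B) (_ : DiscreteTopology B)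
        (_ : MeasurableSpace B) (_ : DiscreteMeasurableSpace B)
        (e : PontryaginDual G ≃ₜ* (A₀ × BlockProduct B)),
        μ = (blockMeasure A₀ B).map e.symm := by
  obtain ⟨U, hU, hUexp⟩ := hbdd
  obtain ⟨A, B, _, _, _, _, _, hφ⟩ :=
    exists_addEquiv_prod_blockCoord (exponentExists_of_isOpen_dual U hU hUexp)
  have : Finite (AddChar A Circle) := .of_equiv _ AddChar.circleEquivComplex.symm.toEquiv
  have : Finite (AddChar B Circle) := .of_equiv _ AddChar.circleEquivComplex.symm.toEquiv
  have : Nontrivial (AddChar B Circle) := by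
    obtain ⟨b, hb⟩ := exists_ne (0 : B)
    obtain ⟨β, hβ⟩ := AddChar.exists_circle_apply_ne_one hb
    exact ⟨β, 1, fun h => hβ (by rw [h, AddChar.one_apply])⟩
  obtain ⟨φ⟩ := hφ (Nat.card (AddChar B Circle)) Nat.card_pos.ne'
  let _ : TopologicalSpace (AddChar A Circle) := ⊥
  have : DiscreteTopology (AddChar A Circle) := ⟨rfl⟩
  let _ : MeasurableSpace (AddChar A Circle) := ⊤
  let _ : TopologicalSpace (AddChar B Circle) := ⊥
  have : DiscreteTopology (AddChar B Circle) := ⟨rfl⟩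
  let _ : MeasurableSpace (AddChar B Circle) := ⊤
  let e := dualContinuousMulEquiv φ
  have he : Measurable e.symm := e.symm.continuous.measurable
  refine ⟨(blockMeasure (AddChar A Circle) (AddChar B Circle)).map e.symm,
    Measure.isProbabilityMeasure_map he.aemeasurable, dualHaar_support_map_blockMeasure e,
    fun p hp => memℓp_of_norm_le_prod (AddChar.natCard_circle B).symm
      (φ := fun g => φ (.ofMul g)) (φ.injective.comp Additive.ofMul.injective)
      (norm_fourierStieltjes_map_blockMeasure_le φ) hp,
    AddChar A Circle, inferInstance, inferInstance, inferInstance, inferInstance, inferInstance,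
    inferInstance, AddChar B Circle, inferInstance, inferInstance, inferInstance, inferInstance,
    inferInstance, inferInstance, inferInstance, e, rfl⟩
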